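/- **Setting.** Let $I$ be a finite set and $d\ge 0$. An adjunction system $\mathcal F=(M_i,M_{ij},f_{ij})_{i,j\in I}$ consists of $d$-dimensional Hausdorff, second-countable topological manifolds $M_i$, subsets $M_{ij}\subseteq M_i$, and continuous maps $f_{ij}:M_{ij}\to M_j$ such that, for all $i,j,k\in I$: $M_{ii}=M_i$ and $f_{ii}=\mathrm{id}_{M_i}$; $f_{ij}(M_{ij})=M_{ji}$ and $f_{ij}^{-1}=f_{ji}$; and for $x\in M_{ij}\cap M_{ik}$ one has $f_{ij}(x)\in M_{jk}$ and $f_{ik}(x)=f_{jk}(f_{ij}(x))$. Assume moreover that every $M_{ij}$ is open in $M_i$ and every $f_{ij}$ is an open topological embedding. Let $\mathbf M=\big(\bigsqcup_i M_i\big)/\!\sim$, where $(x,i)\sim(y,j)$ iff $x\in M_{ij}$ and $f_{ij}(x)=y$, with the quotient topology (so $\mathbf M$ is a possibly non-Hausdorff manifold). Let $\phi_i:M_i\to\mathbf M$ be the canonical maps and $\iota_{ij}:M_{ij}\to M_i$ the inclusions, and for $i_1,\dots,i_p\in I$ put $M_{i_1\cdots i_p}=\phi_{i_1}(M_{i_1})\cap\dots\cap\phi_{i_p}(M_{i_p})$.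 For an abelian group $G$ and a topological space $X$, the group $\check H^q(X)=\check H^q(X,G)$ is the direct limit, over the open covers $\mathcal U=\{U_\alpha\}$ of $X$ ordered by refinement, of the cohomology groups of the Čech complex $\check C^\bullet(X,\mathcal U,G)$. Here a $q$-cochain is a family of locally constant functions $f_{\alpha_0\cdots\alpha_q}:U_{\alpha_0}\cap\cdots\cap U_{\alpha_q}\to G$, and the differential is $(\delta f)_{\alpha_0\cdots\alpha_{q+1}}=\sum_i(-1)^i f_{\alpha_0\cdots\widehat{\alpha_i}\cdots\alpha_{q+1}}$. A continuous map $\varphi: X\to Y$ induces $\varphi^*:\check H^q(Y)\to\check H^q(X)$ by pulling back covers and cochains. **Theorem.** Suppose that all intersections $M_{i_1\cdots i_p}$ ($p\ge 1$, $i_1,\dots,i_p\in I$) are connected, hence in particular non-empty. Then, for every abelian group $G$, the map $c\mapsto(\phi_i^*c)_{i\in I}$ is an isomorphism of $\check H^1(\mathbf M,G)$ onto the fibred product $$\prod_{\mathcal F}\check H^1(M_i,G)=\Big\{(c_i)_{i\in I}\in\prod_{i\in I}\check H^1(M_i,G)\ \Big|\ \iota_{ij}^*c_i=f_{ij}^*c_j\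 \text{in}\ \check H^1(M_{ij},G)\ \text{for all}\ i,j\in I\Big\}.$$ -/

import Mathlib

open TopologicalSpace

universe u v

/-! ### Čech cohomology with coefficients in an abelian group -/

/-- An open cover `{U_α | α ∈ ι}` of the space `X`. -/
structure OpenCover (X : Type u) [TopologicalSpace X] where
  ι : Type u
  set : ι → Opens X
  isOpenCover : IsOpenCover set

namespace OpenCover

variable {X Y Z : Type u} [TopologicalSpace X] [TopologicalSpace Y] [TopologicalSpace Z]

/-- The multiple intersection `U_{α₀ ⋯ α_{q-1}}`. -/
def inter (U : OpenCover X) {q : ℕ} (a : Fin q → U.ι) : Set X :=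
  {x | ∀ k, x ∈ U.set (a k)}

/-- `U ≤ V` when `V` refines `U`: there is `r : V.ι → U.ι` with `V_β ⊆ U_{r β}` for all `β`. -/
instance : Preorder (OpenCover X) where
  le U V := ∃ r : V.ι → U.ι, ∀ b, V.set b ≤ U.set (r b)
  le_refl U := ⟨id, fun _ => le_rfl⟩
  le_trans U V W h₁ h₂ := by
    obtain ⟨r, hr⟩ := h₁
    obtain ⟨s, hs⟩ := h₂
    exact ⟨r ∘ s, fun b => (hs b).trans (hr _)⟩

instance : Nonempty (OpenCover X) :=
  ⟨⟨PUnit, fun _ => ⊤, by simp [IsOpenCover]⟩⟩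

instance : IsDirectedOrder (OpenCover X) where
  directed U V := by
    refine ⟨⟨U.ι × V.ι, fun c => U.set c.1 ⊓ V.set c.2, ?_⟩,
      ⟨Prod.fst, fun _ => inf_le_left⟩, ⟨Prod.snd, fun _ => inf_le_right⟩⟩
    rw [IsOpenCover, eq_top_iff]
    intro x _
    obtain ⟨i, hi⟩ := U.isOpenCover.exists_mem x
    obtain ⟨j, hj⟩ := V.isOpenCover.exists_mem x
    exact Opens.mem_iSup.2 ⟨(i, j), hi, hj⟩

/-- The cover `{φ⁻¹(V_α)}` of `X`, for a continuous map `φ : X → Y` and a cover `V` of `Y`. -/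
abbrev comap (φ : C(X, Y)) (V : OpenCover Y) : OpenCover X where
  ι := V.ι
  set a := (V.set a).comap φ
  isOpenCover := V.isOpenCover.comap φ

/-- `r : U.ι → V.ι` exhibits the cover `U` of `X` as a refinement of `φ⁻¹(V)`.  The case `φ = id` is
that of a refinement map; the case `U = φ⁻¹(V)`, `r = id` is that of pullback along `φ`. -/
def Over (φ : C(X, Y)) (U : OpenCover X) (V : OpenCover Y) (r : U.ι → V.ι) : Prop :=
  ∀ b, U.set b ≤ (V.set (r b)).comap φ

theorem Over.comp {φ : C(X, Y)} {ψ : C(Y, Z)} {U : OpenCover X} {V : OpenCover Y}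
    {W : OpenCover Z} {r : U.ι → V.ι} {s : V.ι → W.ι} (hr : Over φ U V r) (hs : Over ψ V W s) :
    Over (ψ.comp φ) U W (s ∘ r) :=
  fun b _ hx => hs (r b) (hr b hx)

theorem over_comap (φ : C(X, Y)) (V : OpenCover Y) : Over φ (V.comap φ) V id :=
  fun _ => le_rfl

theorem exists_over_of_le {U V : OpenCover X} (h : U ≤ V) :
    ∃ r, Over (ContinuousMap.id X) V U r := h

theorem comap_mono (φ : C(X, Y)) {U V : OpenCover Y} (h : U ≤ V) : U.comap φ ≤ V.comap φ := by
  obtain ⟨r, hr⟩ := h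
  exact ⟨r, fun b _ hx => hr b hx⟩

end OpenCover

noncomputable section

/-! Combinatorics of alternating sums, used to show that the map induced on cohomology by a
refinement does not depend on the choice of the refinement map. -/

namespace CechPrism

variable {S T : Type*} {G : Type v} [AddCommGroup G]

/-- The alternating sum of faces, for functions of tuples. -/
def cd {n : ℕ} (F : (Fin n → T) → G) (a : Fin (n + 1) → T) : G :=
  ∑ i : Fin (n + 1), (-1 : ℤ) ^ (i : ℕ) • F (a ∘ i.succAbove)

/-- The tuple `(p b₀, …, p bᵢ, m bᵢ, …, m b_{n-1})`. -/
def idx (p m : S → T) {n : ℕ} (b : Fin n → S) (i : Fin n) (k : Fin (n + 1)) : T :=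
  if i.castSucc < k then m (b (i.predAbove k)) else p (b (i.predAbove k))

/-- The prism operator. -/
def ch (p m : S → T) {n : ℕ} (F : (Fin (n + 1) → T) → G) (b : Fin n → S) : G :=
  ∑ i : Fin n, (-1 : ℤ) ^ (i : ℕ) • F (idx p m b i)

theorem cd_cons {n : ℕ} (F : (Fin (n + 1) → T) → G) (c : T) (b : Fin (n + 1) → T) :
    cd F (Fin.cons c b) = F b - cd (fun a => F (Fin.cons c a)) b := by
  rw [cd, Fin.sum_univ_succ, cd, sub_eq_add_neg, ← Finset.sum_neg_distrib]
  congr 1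
  · simp [Fin.succAbove_zero, Function.comp_def]
  · refine Finset.sum_congr rfl fun i _ => ?_
    have : (Fin.cons c b : Fin (n + 2) → T) ∘ i.succ.succAbove =
        Fin.cons c (b ∘ i.succAbove) := by
      funext k
      refine Fin.cases ?_ (fun k => ?_) k <;> simp
    rw [this, Fin.val_succ, pow_succ]
    simp

theorem ch_cons (p m : S → T) {n : ℕ} (F : (Fin (n + 2) → T) → G) (c : S) (b : Fin n → S) :
    ch p m F (Fin.cons c b) = F (Fin.cons (p c) (Fin.cons (m c) (m ∘ b))) -
      ch p m (fun a => F (Fin.cons (p c) a)) b := by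
  rw [ch, Fin.sum_univ_succ, ch, sub_eq_add_neg, ← Finset.sum_neg_distrib]
  congr 1
  · have : idx p m (Fin.cons c b : Fin (n + 1) → S) 0 =
        Fin.cons (p c) (Fin.cons (m c) (m ∘ b)) := by
      funext k
      refine Fin.cases ?_ (fun k => ?_) k
      · simp [idx]
      · refine Fin.cases ?_ (fun k => ?_) k <;> simp [idx]
    simp [this]
  · refine Finset.sum_congr rfl fun i _ => ?_
    have : idx p m (Fin.cons c b : Fin (n + 1) → S) i.succ = Fin.cons (p c) (idx p m b i) := by
      funext k
      refine Fin.cases ?_ (fun k => ?_) k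
      · simp [idx]
      · simp [idx, Fin.succ_predAbove_succ]
    rw [this, Fin.val_succ, pow_succ]
    simp

theorem cd_sub {n : ℕ} (F H : (Fin n → T) → G) (a : Fin (n + 1) → T) :
    cd (fun b => F b - H b) a = cd F a - cd H a := by
  simp [cd, smul_sub, Finset.sum_sub_distrib]

theorem ch_sub (p m : S → T) {n : ℕ} (F H : (Fin (n + 1) → T) → G) (b : Fin n → S) :
    ch p m (fun a => F a - H a) b = ch p m F b - ch p m H b := by
  simp [ch, smul_sub, Finset.sum_sub_distrib]

theorem cd_cd {n : ℕ} (F : (Fin n → T) → G) (a : Fin (n + 2) → T) : cd (cd F) a = 0 := by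
  induction n with
  | zero =>
    have h (x y : Fin 0 → T) : F x = F y := congrArg F (Subsingleton.elim _ _)
    simp [cd, Fin.sum_univ_succ, h _ finZeroElim]
  | succ n ih =>
    rw [← Fin.cons_self_tail a, cd_cons]
    simp only [cd_cons, cd_sub, ih]
    simp

theorem homotopy (p m : S → T) {n : ℕ} (F : (Fin (n + 1) → T) → G) (b : Fin (n + 1) → S) :
    cd (ch p m F) b + ch p m (cd F) b = F (m ∘ b) - F (p ∘ b) := by
  induction n with
  | zero =>
    rw [← Fin.cons_self_tail b, ch_cons, cd_cons]
    have h1 : (Fin.cons (m (b 0)) (m ∘ Fin.tail b) : Fin 1 → T) = m ∘ b := by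
      funext k; rw [Subsingleton.elim (α := Fin 1) k 0]; rfl
    have h2 (c : Fin 0 → T) : (Fin.cons (p (b 0)) c : Fin 1 → T) = p ∘ b := by
      funext k; rw [Subsingleton.elim (α := Fin 1) k 0]; rfl
    rw [h1, Fin.cons_self_tail]
    simp [cd, ch, h2]
  | succ n ih =>
    rw [← Fin.cons_self_tail b]
    generalize b 0 = c, Fin.tail b = e
    have h := ih (fun a => F (Fin.cons (p c) a)) e
    have hm (r : S → T) : r ∘ (Fin.cons c e : Fin (n + 2) → S) = Fin.cons (r c) (r ∘ e) := by
      funext k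
      refine Fin.cases ?_ (fun k => ?_) k <;> simp
    rw [ch_cons, cd_cons, cd_cons, cd_cons, hm, hm]
    simp only [ch_cons, cd_cons, cd_sub, ch_sub]
    have h3 : cd (fun a => F (Fin.cons (p c) (Fin.cons (m c) (m ∘ a)))) e =
      cd (fun a => F (Fin.cons (p c) (Fin.cons (m c) a))) (m ∘ e) := rfl
    rw [h3]
    have h4 := eq_sub_of_add_eq h
    rw [h4]
    abel

end CechPrism

/-- The group `Č^q(X, U, G)` of Čech `q`-cochains: a family of locally constant functions
`f_{α₀ ⋯ α_q} : U_{α₀ ⋯ α_q} → G`, one for every tuple of indices. -/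
abbrev CechCochain {X : Type u} [TopologicalSpace X] (U : OpenCover X) (q : ℕ) (G : Type v)
    [AddCommGroup G] : Type (max u v) :=
  ∀ a : Fin (q + 1) → U.ι, LocallyConstant (U.inter a) G

namespace CechCochain

variable {X Y Z : Type u} [TopologicalSpace X] [TopologicalSpace Y] [TopologicalSpace Z]
  {G : Type v} [AddCommGroup G]

/-- Restriction of locally constant functions from `U_{α₀ ⋯ α̂ᵢ ⋯ α_{q+1}}` to
`U_{α₀ ⋯ α_{q+1}}`. -/
def face (U : OpenCover X) {q : ℕ} (a : Fin (q + 2) → U.ι) (i : Fin (q + 2)) :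
    C(U.inter a, U.inter (a ∘ i.succAbove)) where
  toFun x := ⟨x.1, fun k => x.2 (i.succAbove k)⟩
  continuous_toFun := continuous_subtype_val.subtype_mk _

/-- The Čech differential
`(δ f)_{α₀ ⋯ α_{q+1}}(x) = ∑ᵢ (-1)^i f_{α₀ ⋯ α̂ᵢ ⋯ α_{q+1}}(x)`. -/
def d (U : OpenCover X) (q : ℕ) (G : Type v) [AddCommGroup G] :
    CechCochain U q G →+ CechCochain U (q + 1) G :=
  AddMonoidHom.mk'
    (fun f a => ∑ i : Fin (q + 2), (-1 : ℤ) ^ (i : ℕ) • (f (a ∘ i.succAbove)).comap (face U a i))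
    fun f g => by
      funext a
      rw [Pi.add_apply, ← Finset.sum_add_distrib]
      refine Finset.sum_congr rfl fun i _ => ?_
      rw [← smul_add]
      congr 1

theorem d_apply (U : OpenCover X) {q : ℕ} (f : CechCochain U q G) (a : Fin (q + 2) → U.ι)
    (x : U.inter a) :
    d U q G f a x =
      ∑ i : Fin (q + 2), (-1 : ℤ) ^ (i : ℕ) • f (a ∘ i.succAbove) ⟨x.1, fun _ => x.2 _⟩ := by
  change (LocallyConstant.coeFnAddMonoidHom (∑ i : Fin (q + 2), _)) x = _
  rw [map_sum, Finset.sum_apply]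
  rfl

/-- The values at `x` of a cochain, as a function of tuples of indices `α` with `x ∈ U_α`. -/
def valAt {U : OpenCover X} {q : ℕ} (f : CechCochain U q G) (x : X)
    (a : Fin (q + 1) → {α : U.ι // x ∈ U.set α}) : G :=
  f (fun k => (a k).1) ⟨x, fun k => (a k).2⟩

theorem valAt_d {U : OpenCover X} {q : ℕ} (f : CechCochain U q G) (x : X)
    (a : Fin (q + 2) → {α : U.ι // x ∈ U.set α}) :
    valAt (d U q G f) x a = CechPrism.cd (valAt f x) a := by
  rw [valAt, d_apply]
  rfl

theorem ext_valAt {U : OpenCover X} {q : ℕ} {f g : CechCochain U q G}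
    (h : ∀ x a, valAt f x a = valAt g x a) : f = g := by
  funext a
  ext x
  exact h x.1 fun k => ⟨a k, x.2 k⟩

theorem d_d (U : OpenCover X) (q : ℕ) (f : CechCochain U q G) :
    d U (q + 1) G (d U q G f) = 0 := by
  refine ext_valAt fun x a => ?_
  rw [valAt_d, show valAt (d U q G f) x = CechPrism.cd (valAt f x) from funext (valAt_d f x),
    CechPrism.cd_cd]
  rfl

/-- The pullback of cochains `(φ^* f)_{β₀ ⋯ β_q} = f_{r β₀ ⋯ r β_q} ∘ φ` along a continuous map
`φ : X → Y` and a map `r` exhibiting the cover `U` of `X` as a refinement of `φ⁻¹(V)`. -/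
def pull {φ : C(X, Y)} {U : OpenCover X} {V : OpenCover Y} {r : U.ι → V.ι}
    (h : OpenCover.Over φ U V r) (q : ℕ) (G : Type v) [AddCommGroup G] :
    CechCochain V q G →+ CechCochain U q G where
  toFun f a := (f (r ∘ a)).comap
    { toFun := fun x => ⟨φ x.1, fun k => h (a k) (x.2 k)⟩
      continuous_toFun := (φ.continuous.comp continuous_subtype_val).subtype_mk _ }
  map_zero' := rfl
  map_add' _ _ := rfl

theorem pull_d {φ : C(X, Y)} {U : OpenCover X} {V : OpenCover Y} {r : U.ι → V.ι}
    (h : OpenCover.Over φ U V r) {q : ℕ} (f : CechCochain V q G) :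
    pull h (q + 1) G (d V q G f) = d U q G (pull h q G f) := by
  funext a
  ext x
  rw [d_apply]
  exact d_apply V f (r ∘ a) _

/-- The coboundaries `B^q(X, U, G)`. -/
def coboundaries (U : OpenCover X) : (q : ℕ) → (G : Type v) → [AddCommGroup G] →
    AddSubgroup (CechCochain U q G)
  | 0, _, _ => ⊥
  | q + 1, G, _ => (d U q G).range

theorem pull_mem_coboundaries {φ : C(X, Y)} {U : OpenCover X} {V : OpenCover Y} {r : U.ι → V.ι}
    (h : OpenCover.Over φ U V r) {q : ℕ} {f : CechCochain V q G} (hf : f ∈ coboundaries V q G) :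
    pull h q G f ∈ coboundaries U q G := by
  cases q with
  | zero =>
    obtain rfl : f = 0 := hf
    exact map_zero (pull h 0 G)
  | succ q =>
    obtain ⟨g, rfl⟩ := hf
    exact ⟨pull h q G g, (pull_d h g).symm⟩

/-- Two choices of the index map `r` have cohomologous pullbacks on cocycles. -/
theorem pull_sub_pull_mem {φ : C(X, Y)} {U : OpenCover X} {V : OpenCover Y} {r s : U.ι → V.ι}
    (hr : OpenCover.Over φ U V r) (hs : OpenCover.Over φ U V s) {q : ℕ} {f : CechCochain V q G}
    (hf : d V q G f = 0) : pull hs q G f - pull hr q G f ∈ coboundaries U q G := by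
  have key (x : X) (b : Fin (q + 1) → {α : U.ι // x ∈ U.set α}) :
      valAt (pull hs q G f - pull hr q G f) x b =
        CechPrism.cd (CechPrism.ch (fun α : {α : U.ι // x ∈ U.set α} =>
          (⟨r α.1, hr _ α.2⟩ : {β : V.ι // φ x ∈ V.set β}))
          (fun α => ⟨s α.1, hs _ α.2⟩) (valAt f (φ x))) b := by
    have h0 : CechPrism.cd (valAt f (φ x)) = 0 := by
      funext a
      rw [← valAt_d, hf]
      rfl
    have := CechPrism.homotopy (fun α : {α : U.ι // x ∈ U.set α} =>
          (⟨r α.1, hr _ α.2⟩ : {β : V.ι // φ x ∈ V.set β}))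
          (fun α => ⟨s α.1, hs _ α.2⟩) (valAt f (φ x)) b
    rw [h0] at this
    simp only [CechPrism.ch, Pi.zero_apply, smul_zero, Finset.sum_const_zero, add_zero] at this
    exact this.symm
  cases q with
  | zero =>
    refine (ext_valAt fun x b => ?_ : _ = (0 : CechCochain U 0 G))
    rw [key]
    simp only [CechPrism.cd, CechPrism.ch, Finset.univ_eq_empty, Finset.sum_empty, smul_zero,
      Finset.sum_const_zero]
    rfl
  | succ q =>
    have hmem (b : Fin (q + 1) → U.ι) (i : Fin (q + 1)) (x : U.inter b) (k : Fin (q + 2)) :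
        φ x.1 ∈ V.set (CechPrism.idx r s b i k) := by
      unfold CechPrism.idx
      split_ifs
      · exact hs _ (x.2 _)
      · exact hr _ (x.2 _)
    let H : CechCochain U q G := fun b => ∑ i : Fin (q + 1), (-1 : ℤ) ^ (i : ℕ) •
      (f (CechPrism.idx r s b i)).comap
        { toFun := fun x : U.inter b => ⟨φ x.1, fun k => hmem b i x k⟩
          continuous_toFun := (φ.continuous.comp continuous_subtype_val).subtype_mk _ }
    refine ⟨H, ext_valAt fun x b => ?_⟩
    rw [valAt_d, key]
    congr 1
    funext c
    change (LocallyConstant.coeFnAddMonoidHom (∑ i : Fin (q + 1), _)) _ = _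
    rw [map_sum, Finset.sum_apply, CechPrism.ch]
    refine Finset.sum_congr rfl fun i _ => ?_
    change (-1 : ℤ) ^ (i : ℕ) • (f _ _) = (-1 : ℤ) ^ (i : ℕ) • (f _ _)
    congr 1
    have (a a' : Fin (q + 2) → V.ι) (e : a = a') (ha : φ x ∈ V.inter a)
        (ha' : φ x ∈ V.inter a') : f a ⟨φ x, ha⟩ = f a' ⟨φ x, ha'⟩ := by
      subst e
      rfl
    refine this _ _ ?_ _ _
    funext k
    simp only [CechPrism.idx]
    split_ifs <;> rfl

end CechCochain

open CechCochain

/-- The cohomology group `Ȟ^q(X, U, G)` of cocycles modulo coboundaries. -/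
abbrev CoverCohomology {X : Type u} [TopologicalSpace X] (U : OpenCover X) (q : ℕ) (G : Type v)
    [AddCommGroup G] : Type (max u v) :=
  (d U q G).ker ⧸ (coboundaries U q G).addSubgroupOf (d U q G).ker

namespace CoverCohomology

variable {X Y Z : Type u} [TopologicalSpace X] [TopologicalSpace Y] [TopologicalSpace Z]
  {G : Type v} [AddCommGroup G]

/-- The map `Ȟ^q(Y, V, G) → Ȟ^q(X, U, G)` induced by the pullback of cochains. -/
def pull {φ : C(X, Y)} {U : OpenCover X} {V : OpenCover Y} {r : U.ι → V.ι}
    (h : OpenCover.Over φ U V r) (q : ℕ) (G : Type v) [AddCommGroup G] :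
    CoverCohomology V q G →+ CoverCohomology U q G :=
  QuotientAddGroup.map _ _
    (((CechCochain.pull h q G).comp (d V q G).ker.subtype).codRestrict (d U q G).ker fun f => by
      change d U q G (CechCochain.pull h q G f.1) = 0
      rw [← pull_d, show d V q G f.1 = 0 from f.2, map_zero])
    fun _ hf => pull_mem_coboundaries h hf

theorem pull_eq {φ : C(X, Y)} {U : OpenCover X} {V : OpenCover Y} {r s : U.ι → V.ι}
    (hr : OpenCover.Over φ U V r) (hs : OpenCover.Over φ U V s) (q : ℕ) :
    pull hr q G = pull hs q G := by
  ext f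
  refine (QuotientAddGroup.eq (s := (coboundaries U q G).addSubgroupOf (d U q G).ker)).2 ?_
  rw [neg_add_eq_sub]
  exact pull_sub_pull_mem hr hs f.2

theorem pull_pull {φ : C(X, Y)} {ψ : C(Y, Z)} {U : OpenCover X} {V : OpenCover Y}
    {W : OpenCover Z} {r : U.ι → V.ι} {s : V.ι → W.ι} (hr : OpenCover.Over φ U V r)
    (hs : OpenCover.Over ψ V W s) (q : ℕ) (c : CoverCohomology W q G) :
    pull hr q G (pull hs q G c) = pull (hr.comp hs) q G c := by
  induction c using QuotientAddGroup.induction_on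
  rfl

/-- The map `Ȟ^q(X, U, G) → Ȟ^q(X, V, G)` for a refinement `V` of `U`; it does not depend on the
refinement map, by `CoverCohomology.pull_eq`. -/
def refine (q : ℕ) (G : Type v) [AddCommGroup G] (U V : OpenCover X) (h : U ≤ V) :
    CoverCohomology U q G →+ CoverCohomology V q G :=
  pull (OpenCover.exists_over_of_le h).choose_spec q G

instance (q : ℕ) : DirectedSystem (fun U : OpenCover X => CoverCohomology U q G)
    fun U V h => refine q G U V h where
  map_self U c := by
    induction c using QuotientAddGroup.induction_on with
    | H f =>
      have h : OpenCover.Over (ContinuousMap.id X) U U id := fun _ => le_rfl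
      rw [refine, pull_eq _ h]
      rfl
  map_map U V W h₁ h₂ c := by
    rw [refine, refine, pull_pull]
    exact DFunLike.congr_fun (pull_eq _ _ q) c

end CoverCohomology

open scoped Classical in
/-- The Čech cohomology group `Ȟ^q(X, G)`: the direct limit of the groups `Ȟ^q(X, U, G)` over the
open covers of `X`, ordered by refinement. -/
abbrev CechCohomology (q : ℕ) (X : Type u) [TopologicalSpace X] (G : Type v) [AddCommGroup G] :
    Type (max (u + 1) v) :=
  AddCommGroup.DirectLimit (fun U : OpenCover X => CoverCohomology U q G)
    (CoverCohomology.refine q G)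

namespace CechCohomology

open scoped Classical in
/-- The pullback `φ^* : Ȟ^q(Y, G) → Ȟ^q(X, G)` along a continuous map `φ : X → Y`, induced by
`φ^* : Ȟ^q(Y, V, G) → Ȟ^q(X, φ⁻¹(V), G)` for the open covers `V` of `Y`. -/
def pullback (q : ℕ) (G : Type v) [AddCommGroup G] {X Y : Type u} [TopologicalSpace X]
    [TopologicalSpace Y] (φ : C(X, Y)) : CechCohomology q Y G →+ CechCohomology q X G :=
  AddCommGroup.DirectLimit.lift _ _ _
    (fun V => (AddCommGroup.DirectLimit.of _ (CoverCohomology.refine q G) (V.comap φ)).comp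
      (CoverCohomology.pull (OpenCover.over_comap φ V) q G))
    fun V W h c => by
      rw [AddMonoidHom.comp_apply, AddMonoidHom.comp_apply,
        ← AddCommGroup.DirectLimit.of_f (OpenCover.comap_mono φ h)]
      refine congrArg _ ?_
      refine (CoverCohomology.pull_pull _ _ q c).trans (.trans ?_
        (CoverCohomology.pull_pull _ _ q c).symm)
      exact DFunLike.congr_fun (CoverCohomology.pull_eq _ _ q) c

end CechCohomology

/-! ### Adjunction spaces -/

/-- An adjunction system: spaces `M i`, gluing regions `M_ij ⊆ M i` and continuous gluing maps
`f_ij : M_ij → M j` subject to the conditions A1, A2, A3. -/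
structure AdjunctionSystem {I : Type} (M : I → Type u) [∀ i, TopologicalSpace (M i)] where
  /-- The gluing region `M_ij`. -/
  region (i j : I) : Set (M i)
  /-- The gluing map `f_ij`. -/
  glue (i j : I) : C(region i j, M j)
  region_self (i : I) : region i i = Set.univ
  glue_self (i : I) (x : region i i) : glue i i x = x
  range_glue (i j : I) : Set.range (glue i j) = region j i
  glue_glue (i j : I) (x : region i j) (h : glue i j x ∈ region j i) : glue j i ⟨_, h⟩ = x
  cocycle (i j k : I) (x : M i) (hj : x ∈ region i j) (hk : x ∈ region i k) :
    ∃ h : glue i j ⟨x, hj⟩ ∈ region j k, glue j k ⟨_, h⟩ = glue i k ⟨x, hk⟩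

namespace AdjunctionSystem

variable {I : Type} {M : I → Type u} [∀ i, TopologicalSpace (M i)] (F : AdjunctionSystem M)

/-- The gluing regions are open and the gluing maps are open embeddings. -/
structure IsOpenGluing : Prop where
  isOpen_region (i j : I) : IsOpen (F.region i j)
  isOpenEmbedding_glue (i j : I) : Topology.IsOpenEmbedding (F.glue i j)

/-- The equivalence relation on the disjoint union of the `M i` identifying `(x, i)` with `(f_ij(x), j)`. -/
def setoid : Setoid (Σ i, M i) where
  r p q := ∃ h : p.2 ∈ F.region p.1 q.1, F.glue p.1 q.1 ⟨p.2, h⟩ = q.2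
  iseqv := by
    refine ⟨fun p => ⟨by rw [F.region_self]; trivial, F.glue_self _ _⟩, ?_, ?_⟩
    · rintro ⟨i, x⟩ ⟨j, y⟩ ⟨(h : x ∈ F.region i j), (e : F.glue i j ⟨x, h⟩ = y)⟩
      subst e
      have h' : F.glue i j ⟨x, h⟩ ∈ F.region j i := F.range_glue i j ▸ Set.mem_range_self _
      exact ⟨h', F.glue_glue i j ⟨x, h⟩ h'⟩
    · rintro ⟨i, x⟩ ⟨j, y⟩ ⟨k, z⟩ ⟨(h : x ∈ F.region i j), (e : F.glue i j ⟨x, h⟩ = y)⟩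
        ⟨(h₂ : y ∈ F.region j k), (e₂ : F.glue j k ⟨y, h₂⟩ = z)⟩
      subst e
      subst e₂
      have h' : F.glue i j ⟨x, h⟩ ∈ F.region j i := F.range_glue i j ▸ Set.mem_range_self _
      obtain ⟨h₃, h₄⟩ := F.cocycle j i k _ h' h₂
      have e : F.glue j i ⟨_, h'⟩ = x := F.glue_glue i j ⟨x, h⟩ h'
      simp only [e] at h₃ h₄
      exact ⟨h₃, h₄⟩

/-- The adjunction space subordinate to `F`, with the quotient topology. -/
def Space : Type u := Quotient F.setoid

instance : TopologicalSpace F.Space :=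
  inferInstanceAs (TopologicalSpace (Quotient F.setoid))

/-- The canonical map `φ_i : M i → ⋃_F M i`, `x ↦ [x, i]`. -/
def toSpace (i : I) : C(M i, F.Space) where
  toFun x := Quotient.mk F.setoid ⟨i, x⟩
  continuous_toFun := continuous_quotient_mk'.comp continuous_sigmaMk

/-- The intersection `M_{i₁ ⋯ i_p}` of the `M i`, `i ∈ s = {i₁, …, i_p}`, as subspaces of the
adjunction space. -/
def inter (s : Finset I) : Set F.Space :=
  ⋂ i ∈ s, Set.range (F.toSpace i)

/-- The inclusion `ι_ij : M_ij → M i`. -/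
def incl (i j : I) : C(F.region i j, M i) where
  toFun := Subtype.val

/-- The fibred product `∏_F Ȟ^q(M i, G)`: the families `c` with `ι_ij^* c_i = f_ij^* c_j` in
`Ȟ^q(M_ij, G)` for all `i, j`. -/
def fibredProduct (q : ℕ) (G : Type v) [AddCommGroup G] :
    AddSubgroup (∀ i, CechCohomology q (M i) G) where
  carrier := {c | ∀ i j, CechCohomology.pullback q G (F.incl i j) (c i) =
    CechCohomology.pullback q G (F.glue i j) (c j)}
  zero_mem' i j := by simp
  add_mem' hc hc' i j := by simp [hc i j, hc' i j]
  neg_mem' hc i j := by simp [hc i j]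

end AdjunctionSystem

end

/-! ### Čech cohomology in degree one by cocycles of total functions -/

/-! The connectedness hypothesis says that the cover of the adjunction space by the sets `F.toSpace
i (M i)` looks, to locally constant functions, like a full simplex: all intersections are non-empty,
and a locally constant function on one of them is a constant. The resulting complex of constants `k
i j`, `k i j l`, … is acyclic in positive degrees, a contraction being given by inserting a fixed
index `o` in the last place. Vanishing in degree one gives injectivity, and vanishing in degree two
gives surjectivity; this is the low-degree part of the Mayer–Vietoris spectral sequence, written out
with cocycles.

For injectivity (`pullback_toSpace_injective`), two classes that agree on each `M i` are related
there by a cochain `H i`. On a double intersection `H i - H j` is a constant `k i j`, and a point of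
the triple intersection with `o` shows `k i j = k i o - k j o`. The corrected cochains `H i - k i o`
therefore agree on overlaps and form one global cochain.

For surjectivity (`exists_pullback_toSpace_eq`), a compatible family supplies comparison functions
`H i j` on double intersections. Their failure to be a cocycle is a constant `k i j l` on each
triple intersection, and a point of the fourfold intersection with `o` shows `k i j l = k i j o + k
j l o - k i l o`. Hence `H i j - k i j o` is a cocycle on the adjunction space, and it restricts to
the given classes.

Both arguments rest on `LocalCocycle.cechClass_eq_iff`: in degree one, equality in the direct limit
can be tested on the intersections of two given covers, without further refinement.
`IsPreconnected.exists_eq_of_locConstAt` turns local constancy into actual constants. -/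

open Filter Topology

/-- The function `f` is constant near `x`. -/
def LocConstAt {X G : Type*} [TopologicalSpace X] (f : X → G) (x : X) : Prop :=
  ∀ᶠ y in 𝓝 x, f y = f x

namespace LocConstAt

variable {X Y G : Type*} [TopologicalSpace X] [TopologicalSpace Y]

theorem const (c : G) (x : X) : LocConstAt (fun _ => c) x :=
  Eventually.of_forall fun _ => rfl

theorem map₂ {A B C : Type*} {f : X → A} {g : X → B} {x : X} (op : A → B → C)
    (hf : LocConstAt f x) (hg : LocConstAt g x) : LocConstAt (fun y => op (f y) (g y)) x := by
  filter_upwards [hf, hg] with y h₁ h₂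
  rw [h₁, h₂]

theorem add [Add G] {f g : X → G} {x : X} (hf : LocConstAt f x) (hg : LocConstAt g x) :
    LocConstAt (fun y => f y + g y) x :=
  hf.map₂ (· + ·) hg

theorem sub [Sub G] {f g : X → G} {x : X} (hf : LocConstAt f x) (hg : LocConstAt g x) :
    LocConstAt (fun y => f y - g y) x :=
  hf.map₂ (· - ·) hg

theorem congr {f g : X → G} {x : X} (hf : LocConstAt f x) (h : ∀ᶠ y in 𝓝 x, g y = f y) :
    LocConstAt g x := by
  filter_upwards [hf, h] with y h₁ h₂
  rw [h₂, h₁, h.self_of_nhds]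

theorem comp {f : Y → G} {φ : X → Y} {x : X} (hf : LocConstAt f (φ x)) (hφ : ContinuousAt φ x) :
    LocConstAt (fun y => f (φ y)) x :=
  hφ.eventually hf

/-- Neighbourhoods of `φ x` are generated by images of neighbourhoods of `x`, so the values `f₀` off
the range play no role. -/
theorem extend {φ : X → Y} (hφ : IsOpenEmbedding φ) {f : X → G} {f₀ : Y → G} {x : X}
    (hf : LocConstAt f x) : LocConstAt (Function.extend φ f f₀) (φ x) := by
  rw [LocConstAt, ← hφ.map_nhds_eq, eventually_map]
  filter_upwards [hf] with y h
  rw [hφ.injective.extend_apply, hφ.injective.extend_apply, h]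

theorem isLocallyConstant_restrict {s : Set X} {f : X → G} (h : ∀ x ∈ s, LocConstAt f x) :
    IsLocallyConstant fun x : s => f x :=
  (IsLocallyConstant.iff_eventually_eq _).2 fun x =>
    (h x x.2).comp continuous_subtype_val.continuousAt

end LocConstAt

/-- Locally constant functions that agree on overlaps and are defined on the members of an open
cover of a connected set are all equal to the same constant. -/
theorem IsPreconnected.exists_eq_of_locConstAt {X A G : Type*} [TopologicalSpace X] [Zero G]
    {S : Set X} (hS : IsPreconnected S) (D : A → Set X) (f : A → X → G)
    (hD : ∀ a, IsOpen (D a)) (hcov : ∀ x ∈ S, ∃ a, x ∈ D a)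
    (hf : ∀ a, ∀ x ∈ S, x ∈ D a → LocConstAt (f a) x)
    (hfe : ∀ a b, ∀ x ∈ S, x ∈ D a → x ∈ D b → f a x = f b x) :
    ∃ k, ∀ a, ∀ x ∈ S, x ∈ D a → f a x = k := by
  rcases S.eq_empty_or_nonempty with rfl | ⟨x₀, hx₀⟩
  · exact ⟨0, by simp⟩
  have : Nonempty A := ⟨(hcov x₀ hx₀).choose⟩
  -- By agreement on overlaps, the value at `x` of the member chosen by `c` does not depend on the
  -- choice; near `x` the fixed member `c x` may be used, whence local constancy.
  choose! c hc using hcov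
  have hloc : IsLocallyConstant fun x : S => f (c x) x := by
    rw [IsLocallyConstant.iff_eventually_eq]
    intro x
    have h₁ := continuous_subtype_val.continuousAt.eventually (hf (c x) x x.2 (hc x x.2))
    have h₂ := continuous_subtype_val.continuousAt.eventually
      ((hD (c x)).mem_nhds (hc x x.2))
    filter_upwards [h₁, h₂] with y h₁ h₂
    rw [← h₁]
    exact hfe _ _ y y.2 (hc y y.2) h₂
  have : PreconnectedSpace S := Subtype.preconnectedSpace hS
  refine ⟨f (c x₀) x₀, fun a x hx hxa => ?_⟩
  rw [hfe a (c x) x hx hxa (hc x hx)]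
  exact hloc.apply_eq_of_isPreconnected isPreconnected_univ (x := ⟨x, hx⟩) (y := ⟨x₀, hx₀⟩)
    trivial trivial

/-! ### Cochains of degree at most two as functions on the whole space -/

namespace CechCochain

variable {X : Type u} [TopologicalSpace X] {G : Type v} [AddCommGroup G] {U : OpenCover X}

open scoped Classical in
/-- The extension by zero of the values of a cochain to the whole space. -/
noncomputable def extendZero {q : ℕ} (f : CechCochain U q G) (a : Fin (q + 1) → U.ι) (x : X) : G :=
  if h : x ∈ U.inter a then f a ⟨x, h⟩ else 0

theorem extendZero_coe {q : ℕ} (f : CechCochain U q G) (a : Fin (q + 1) → U.ι)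
    (x : U.inter a) : f.extendZero a x = f a x :=
  dif_pos x.2

theorem isOpen_inter {q : ℕ} (a : Fin q → U.ι) : IsOpen (U.inter a) := by
  simp only [OpenCover.inter, Set.ofPred_forall]
  exact isOpen_iInter_of_finite fun k => (U.set (a k)).isOpen

theorem locConstAt_extendZero {q : ℕ} (f : CechCochain U q G) {a : Fin (q + 1) → U.ι} {x : X}
    (hx : x ∈ U.inter a) : LocConstAt (f.extendZero a) x := by
  have h := (IsLocallyConstant.iff_eventually_eq _).1 (f a).isLocallyConstant ⟨x, hx⟩
  rw [nhds_subtype, eventually_comap] at h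
  filter_upwards [h, (isOpen_inter a).mem_nhds hx] with y hy hya
  exact (extendZero_coe f a ⟨y, hya⟩).trans
    ((hy ⟨y, hya⟩ rfl).trans (extendZero_coe f a ⟨x, hx⟩).symm)

theorem extendZero_d {q : ℕ} (f : CechCochain U q G) {a : Fin (q + 2) → U.ι} {x : X}
    (hx : x ∈ U.inter a) : (d U q G f).extendZero a x =
      ∑ i : Fin (q + 2), (-1 : ℤ) ^ (i : ℕ) • f.extendZero (a ∘ i.succAbove) x := by
  refine (extendZero_coe _ _ ⟨x, hx⟩).trans ((d_apply U f a ⟨x, hx⟩).trans ?_)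
  exact Finset.sum_congr rfl fun i _ =>
    congrArg _ (extendZero_coe f (a ∘ i.succAbove) ⟨x, fun k => hx _⟩).symm

theorem extendZero_zero_d (f : CechCochain U 0 G) {a b : U.ι} {x : X} (ha : x ∈ U.set a)
    (hb : x ∈ U.set b) : (d U 0 G f).extendZero ![a, b] x =
      f.extendZero ![b] x - f.extendZero ![a] x := by
  rw [extendZero_d, Fin.sum_univ_two,
    show (![a, b] ∘ (0 : Fin 2).succAbove : Fin 1 → U.ι) = ![b] by ext k; fin_cases k; rfl,
    show (![a, b] ∘ (1 : Fin 2).succAbove : Fin 1 → U.ι) = ![a] by ext k; fin_cases k; rfl]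
  · simp [sub_eq_add_neg]
  · intro k; fin_cases k <;> assumption

theorem extendZero_one_d (f : CechCochain U 1 G) {a b c : U.ι} {x : X} (ha : x ∈ U.set a)
    (hb : x ∈ U.set b) (hc : x ∈ U.set c) : (d U 1 G f).extendZero ![a, b, c] x =
      f.extendZero ![b, c] x - f.extendZero ![a, c] x + f.extendZero ![a, b] x := by
  rw [extendZero_d, Fin.sum_univ_three,
    show (![a, b, c] ∘ (0 : Fin 3).succAbove : Fin 2 → U.ι) = ![b, c] by
      ext k; fin_cases k <;> rfl,
    show (![a, b, c] ∘ (1 : Fin 3).succAbove : Fin 2 → U.ι) = ![a, c] by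
      ext k; fin_cases k <;> rfl,
    show (![a, b, c] ∘ (2 : Fin 3).succAbove : Fin 2 → U.ι) = ![a, b] by
      ext k; fin_cases k <;> rfl]
  · simp [sub_eq_add_neg]
  · intro k; fin_cases k <;> assumption

theorem ext_extendZero_one {f f' : CechCochain U 1 G}
    (h : ∀ a b x, x ∈ U.set a → x ∈ U.set b → f.extendZero ![a, b] x = f'.extendZero ![a, b] x) :
    f = f' := by
  funext a
  ext ⟨x, hx⟩
  have e : a = ![a 0, a 1] := by ext k; fin_cases k <;> rfl
  rw [← extendZero_coe, ← extendZero_coe]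
  change f.extendZero a x = f'.extendZero a x
  rw [e]
  exact h _ _ x (hx 0) (hx 1)

end CechCochain

/-- A Čech `1`-cocycle for the cover `U`, given by functions on all of `X` whose values outside
the double intersections do not matter. -/
structure LocalCocycle {X : Type u} [TopologicalSpace X] (U : OpenCover X) (G : Type v)
    [AddCommGroup G] where
  /-- The value of the cocycle. -/
  val : U.ι → U.ι → X → G
  locConst : ∀ a b x, x ∈ U.set a → x ∈ U.set b → LocConstAt (val a b) x
  cocycle : ∀ a b c x, x ∈ U.set a → x ∈ U.set b → x ∈ U.set c →
    val a b x + val b c x = val a c x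

/-! ### Classes of degree-one cocycles and their equality -/

namespace LocalCocycle

variable {X Y Z : Type u} [TopologicalSpace X] [TopologicalSpace Y] [TopologicalSpace Z]
  {G : Type v} [AddCommGroup G] {U V : OpenCover X}

theorem val_self (g : LocalCocycle U G) {a : U.ι} {x : X} (h : x ∈ U.set a) :
    g.val a a x = 0 := by
  simpa using g.cocycle a a a x h h h

/-- The Čech cochain with the values of `g`. -/
def toCochain (g : LocalCocycle U G) : CechCochain U 1 G := fun a =>
  ⟨fun x => g.val (a 0) (a 1) x,
    LocConstAt.isLocallyConstant_restrict fun x hx => g.locConst _ _ x (hx 0) (hx 1)⟩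

theorem extendZero_toCochain (g : LocalCocycle U G) {a b : U.ι} {x : X} (ha : x ∈ U.set a)
    (hb : x ∈ U.set b) : g.toCochain.extendZero ![a, b] x = g.val a b x :=
  CechCochain.extendZero_coe g.toCochain ![a, b] ⟨x, fun k => by fin_cases k <;> assumption⟩

theorem d_toCochain (g : LocalCocycle U G) : CechCochain.d U 1 G g.toCochain = 0 := by
  funext a
  ext ⟨x, hx⟩
  have e : a = ![a 0, a 1, a 2] := by ext k; fin_cases k <;> rfl
  rw [← CechCochain.extendZero_coe]
  change (CechCochain.d U 1 G g.toCochain).extendZero a x = 0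
  rw [e, CechCochain.extendZero_one_d _ (hx 0) (hx 1) (hx 2),
    extendZero_toCochain _ (hx 1) (hx 2), extendZero_toCochain _ (hx 0) (hx 2),
    extendZero_toCochain _ (hx 0) (hx 1),
    ← g.cocycle (a 0) (a 1) (a 2) x (hx 0) (hx 1) (hx 2)]
  abel

/-- The class of `g` in the cohomology of the cover. -/
def coverClass (g : LocalCocycle U G) : CoverCohomology U 1 G :=
  QuotientAddGroup.mk ⟨g.toCochain, g.d_toCochain⟩

theorem exists_coverClass_eq (c : CoverCohomology U 1 G) : ∃ g : LocalCocycle U G,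
    g.coverClass = c := by
  induction c using QuotientAddGroup.induction_on with
  | H f =>
    obtain ⟨f, hf⟩ := f
    have hf' : CechCochain.d U 1 G f = 0 := hf
    let g : LocalCocycle U G := {
      val a b := f.extendZero ![a, b]
      locConst a b x ha hb := f.locConstAt_extendZero fun k => by fin_cases k <;> assumption
      cocycle a b c x ha hb hc := by
        have h := f.extendZero_one_d ha hb hc
        rw [hf', show (0 : CechCochain U 2 G).extendZero ![a, b, c] x = 0 by
          unfold CechCochain.extendZero; split_ifs <;> rfl] at h
        rw [← sub_eq_zero, h]
        abel }
    refine ⟨g, congrArg QuotientAddGroup.mk (Subtype.ext ?_)⟩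
    exact CechCochain.ext_extendZero_one fun a b x ha hb => g.extendZero_toCochain ha hb

/-- The relation is `δ H = g' - g`, written without subtraction so that it also makes sense for
cocycles on two different covers. -/
theorem coverClass_eq_iff {g g' : LocalCocycle U G} : g.coverClass = g'.coverClass ↔
    ∃ H : U.ι → X → G, (∀ a x, x ∈ U.set a → LocConstAt (H a) x) ∧
      ∀ a b x, x ∈ U.set a → x ∈ U.set b → H a x + g'.val a b x = g.val a b x + H b x := by
  have hsub {a b : U.ι} {x : X} (ha : x ∈ U.set a) (hb : x ∈ U.set b) :
      (-g.toCochain + g'.toCochain).extendZero ![a, b] x = -g.val a b x + g'.val a b x :=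
    CechCochain.extendZero_coe (-g.toCochain + g'.toCochain) ![a, b]
      ⟨x, fun k => by fin_cases k <;> assumption⟩
  have hiff (s t p q : G) : s - t = -p + q ↔ t + q = p + s := by
    rw [sub_eq_iff_eq_add, ← sub_eq_zero, ← sub_eq_zero (a := t + q), ← neg_eq_zero]
    refine Eq.congr_left ?_
    abel
  rw [coverClass, coverClass, QuotientAddGroup.eq]
  constructor
  · rintro ⟨K, hK⟩
    replace hK : CechCochain.d U 0 G K = -g.toCochain + g'.toCochain := hK
    refine ⟨fun a => K.extendZero ![a], fun a x hx => K.locConstAt_extendZero fun k => ?_,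
      fun a b x ha hb => ?_⟩
    · fin_cases k; exact hx
    · rw [← hiff, ← K.extendZero_zero_d ha hb, hK, hsub ha hb]
  · rintro ⟨H, hH, hgg⟩
    let K : CechCochain U 0 G := fun a => ⟨fun x => H (a 0) x,
      LocConstAt.isLocallyConstant_restrict fun x hx => hH _ x (hx 0)⟩
    have hK {a : U.ι} {x : X} (ha : x ∈ U.set a) : K.extendZero ![a] x = H a x :=
      CechCochain.extendZero_coe K ![a] ⟨x, fun k => by fin_cases k; assumption⟩
    refine ⟨K, CechCochain.ext_extendZero_one fun a b x ha hb => ?_⟩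
    rw [K.extendZero_zero_d ha hb, hK ha, hK hb]
    refine Eq.trans ?_ (hsub ha hb).symm
    rw [hiff, hgg a b x ha hb]

/-- The pullback of a cocycle. -/
def comap {φ : C(X, Y)} {V : OpenCover Y} {r : U.ι → V.ι} (g : LocalCocycle V G)
    (h : OpenCover.Over φ U V r) : LocalCocycle U G where
  val a b x := g.val (r a) (r b) (φ x)
  locConst a b _ ha hb := (g.locConst _ _ _ (h a ha) (h b hb)).comp φ.continuous.continuousAt
  cocycle a b c _ ha hb hc := g.cocycle _ _ _ _ (h a ha) (h b hb) (h c hc)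

theorem pull_coverClass {φ : C(X, Y)} {V : OpenCover Y} {r : U.ι → V.ι} (g : LocalCocycle V G)
    (h : OpenCover.Over φ U V r) :
    CoverCohomology.pull h 1 G g.coverClass = (g.comap h).coverClass :=
  rfl

open scoped Classical in
/-- The class of `g` in the Čech cohomology of the space. -/
noncomputable def cechClass (g : LocalCocycle U G) : CechCohomology 1 X G :=
  AddCommGroup.DirectLimit.of _ (CoverCohomology.refine 1 G) U g.coverClass

theorem exists_cechClass_eq (c : CechCohomology 1 X G) :
    ∃ (U : OpenCover X) (g : LocalCocycle U G), g.cechClass = c := by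
  classical
  induction c using AddCommGroup.DirectLimit.induction_on with
  | ih U x =>
    obtain ⟨g, rfl⟩ := exists_coverClass_eq x
    exact ⟨U, g, rfl⟩

theorem pullback_cechClass (φ : C(X, Y)) {V : OpenCover Y} (g : LocalCocycle V G) :
    CechCohomology.pullback 1 G φ g.cechClass =
      (g.comap (OpenCover.over_comap φ V)).cechClass := by
  classical
  exact AddCommGroup.DirectLimit.lift_of _ _ _ _ _

/-- The transition map of the direct limit uses some refinement map, and `CoverCohomology.pull_eq`
allows it to be replaced by `r`. -/
theorem cechClass_comap (g : LocalCocycle V G) {r : U.ι → V.ι}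
    (h : OpenCover.Over (ContinuousMap.id X) U V r) : (g.comap h).cechClass = g.cechClass := by
  classical
  have hle : V ≤ U := ⟨r, h⟩
  rw [cechClass, cechClass, ← AddCommGroup.DirectLimit.of_f hle, ← pull_coverClass]
  exact congrArg _ (DFunLike.congr_fun (CoverCohomology.pull_eq _ _ 1) _)

theorem exists_coverClass_comap_eq {g : LocalCocycle U G} {g' : LocalCocycle V G}
    (h : g.cechClass = g'.cechClass) : ∃ (W : OpenCover X) (r : W.ι → U.ι) (s : W.ι → V.ι)
      (hr : OpenCover.Over (ContinuousMap.id X) W U r)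
      (hs : OpenCover.Over (ContinuousMap.id X) W V s),
      (g.comap hr).coverClass = (g'.comap hs).coverClass := by
  classical
  obtain ⟨W₀, hU, hV⟩ := exists_ge_ge U V
  obtain ⟨r, hr⟩ := OpenCover.exists_over_of_le hU
  obtain ⟨s, hs⟩ := OpenCover.exists_over_of_le hV
  rw [← cechClass_comap g hr, ← cechClass_comap g' hs, cechClass, cechClass] at h
  -- A class that vanishes in a direct limit already vanishes at a later stage; equality is reduced
  -- to this by taking a difference.
  have h₀ : AddCommGroup.DirectLimit.of _ (CoverCohomology.refine 1 G) W₀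
      ((g.comap hr).coverClass - (g'.comap hs).coverClass) = 0 := by
    have h₁ := (AddCommGroup.DirectLimit.of _ (CoverCohomology.refine 1 G) W₀).map_add
      ((g.comap hr).coverClass - (g'.comap hs).coverClass) (g'.comap hs).coverClass
    rw [sub_add_cancel, h] at h₁
    have h₂ {A : Type _} [AddCommGroup A] (z w : A) (h : w = z + w) : z = 0 :=
      add_eq_right.1 h.symm
    exact h₂ (A := CechCohomology 1 X G) _ _ h₁
  obtain ⟨W, hW, h⟩ := AddCommGroup.DirectLimit.of.zero_exact _ _ h₀
  rw [map_sub, sub_eq_zero] at h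
  exact ⟨W, _, _, (OpenCover.exists_over_of_le hW).choose_spec.comp hr,
    (OpenCover.exists_over_of_le hW).choose_spec.comp hs, h⟩

/-- Two cocycles on possibly different covers are cohomologous. -/
def Cohomologous (g : LocalCocycle U G) (g' : LocalCocycle V G) : Prop :=
  ∃ h : U.ι → V.ι → X → G,
    (∀ a b x, x ∈ U.set a → x ∈ V.set b → LocConstAt (h a b) x) ∧
    ∀ a a' b b' x, x ∈ U.set a → x ∈ U.set a' → x ∈ V.set b → x ∈ V.set b' →
      h a b x + g'.val b b' x = g.val a a' x + h a' b' x

/-- A cochain `H` on a refinement `W` transports to each intersection of a member of `U` with one of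
`V` by adding the cocycles `g` and `g'` on either side. The local expressions agree on overlaps, so
they glue and `W` disappears. Conversely, such a family is a `0`-cochain on the cover by these
intersections. -/
theorem cechClass_eq_iff {g : LocalCocycle U G} {g' : LocalCocycle V G} :
    g.cechClass = g'.cechClass ↔ g.Cohomologous g' := by
  constructor
  · intro h
    obtain ⟨W, r, s, hr, hs, h⟩ := exists_coverClass_comap_eq h
    obtain ⟨H, hH, hgg⟩ := coverClass_eq_iff.1 h
    choose c hc using W.isOpenCover.exists_mem
    -- The path from `a` to `b` through `w`: from `a` to `r w` by `g`, across by `H w`, then from `s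
    -- w` to `b` by `g'`.
    let k (w : W.ι) (a : U.ι) (b : V.ι) (x : X) : G := g.val a (r w) x + H w x + g'.val (s w) b x
    have hk (w w' a b x) (hw : x ∈ W.set w) (hw' : x ∈ W.set w') (ha : x ∈ U.set a)
        (hb : x ∈ V.set b) : k w a b x = k w' a b x := by
      have h₁ := g.cocycle a (r w) (r w') x ha (hr _ hw) (hr _ hw')
      have h₂ := g'.cocycle (s w) (s w') b x (hs _ hw) (hs _ hw') hb
      have h₃ : H w x + g'.val (s w) (s w') x = g.val (r w) (r w') x + H w' x :=
        hgg w w' x hw hw'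
      simp only [k]
      rw [← h₁, ← h₂, add_assoc, ← add_assoc (H w x), h₃]
      abel
    refine ⟨fun a b x => k (c x) a b x, fun a b x ha hb => ?_,
      fun a a' b b' x ha ha' hb hb' => ?_⟩
    · have : LocConstAt (k (c x) a b) x :=
        ((g.locConst _ _ x ha (hr _ (hc x))).add (hH _ x (hc x))).add
          (g'.locConst _ _ x (hs _ (hc x)) hb)
      refine this.congr ?_
      filter_upwards [(W.set (c x)).isOpen.mem_nhds (hc x), (U.set a).isOpen.mem_nhds ha,
        (V.set b).isOpen.mem_nhds hb] with y hy hya hyb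
      exact hk _ _ _ _ _ (hc y) hy hya hyb
    · simp only [k]
      rw [← g.cocycle a a' (r (c x)) x ha ha' (hr _ (hc x)),
        ← g'.cocycle (s (c x)) b b' x (hs _ (hc x)) hb hb']
      abel
  · rintro ⟨h, hloc, hh⟩
    let W : OpenCover X := ⟨U.ι × V.ι, fun w => U.set w.1 ⊓ V.set w.2, by
      rw [IsOpenCover, eq_top_iff]
      intro x _
      obtain ⟨i, hi⟩ := U.isOpenCover.exists_mem x
      obtain ⟨j, hj⟩ := V.isOpenCover.exists_mem x
      exact Opens.mem_iSup.2 ⟨(i, j), hi, hj⟩⟩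
    have hr : OpenCover.Over (ContinuousMap.id X) W U Prod.fst := fun w x hx => hx.1
    have hs : OpenCover.Over (ContinuousMap.id X) W V Prod.snd := fun w x hx => hx.2
    rw [← cechClass_comap g hr, ← cechClass_comap g' hs]
    have : (g.comap hr).coverClass = (g'.comap hs).coverClass := by
      refine coverClass_eq_iff.2 ⟨fun w => h w.1 w.2, fun w x hx => ?_, fun w w' x hx hx' => ?_⟩
      · exact hloc _ _ x hx.1 hx.2
      · exact hh _ _ _ _ x hx.1 hx'.1 hx.2 hx'.2
    rw [cechClass, this, cechClass]

end LocalCocycle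

theorem CechCohomology.pullback_pullback {X Y Z : Type u} [TopologicalSpace X]
    [TopologicalSpace Y] [TopologicalSpace Z] {G : Type v} [AddCommGroup G] (φ : C(X, Y))
    (ψ : C(Y, Z)) (c : CechCohomology 1 Z G) :
    pullback 1 G φ (pullback 1 G ψ c) = pullback 1 G (ψ.comp φ) c := by
  obtain ⟨U, g, rfl⟩ := LocalCocycle.exists_cechClass_eq c
  simp only [LocalCocycle.pullback_cechClass]
  rfl

/-! ### The glued cohomology of an adjunction space -/

namespace AdjunctionSystem

variable {I : Type} {M : I → Type u} [∀ i, TopologicalSpace (M i)] {F : AdjunctionSystem M}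
  {G : Type v} [AddCommGroup G]

theorem toSpace_eq_iff {i j : I} {x : M i} {y : M j} : F.toSpace i x = F.toSpace j y ↔
    ∃ h : x ∈ F.region i j, F.glue i j ⟨x, h⟩ = y :=
  Quotient.eq (r := F.setoid)

theorem toSpace_glue {i j : I} (x : F.region i j) :
    F.toSpace j (F.glue i j x) = F.toSpace i x :=
  (toSpace_eq_iff.2 ⟨x.2, rfl⟩).symm

theorem toSpace_comp_incl (i j : I) :
    (F.toSpace i).comp (F.incl i j) = (F.toSpace j).comp (F.glue i j) :=
  ContinuousMap.ext fun x => (toSpace_glue x).symm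

theorem toSpace_injective (i : I) : Function.Injective (F.toSpace i) := by
  intro x y h
  obtain ⟨h, e⟩ := toSpace_eq_iff.1 h
  rw [← e, F.glue_self]

theorem exists_toSpace_eq (x : F.Space) : ∃ i y, F.toSpace i y = x := by
  obtain ⟨⟨i, y⟩, rfl⟩ := Quotient.exists_rep x
  exact ⟨i, y, rfl⟩

/-- The preimage in `M j` of the image of an open `V` in `M i` is the preimage of `V` under `F.glue
j i`, open in the open set `F.region j i`. -/
theorem IsOpenGluing.isOpenEmbedding_toSpace (hF : F.IsOpenGluing) (i : I) :
    IsOpenEmbedding (F.toSpace i) := by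
  refine .of_continuous_injective_isOpenMap (F.toSpace i).continuous (toSpace_injective i)
    fun V hV => ?_
  refine isOpen_coinduced.2 (isOpen_sigma_iff.2 fun j => ?_)
  convert (hF.isOpen_region j i).isOpenMap_subtype_val _ (hV.preimage (F.glue j i).continuous)
    using 1
  ext y
  constructor
  · rintro ⟨x, hx, h⟩
    obtain ⟨hy, rfl⟩ := toSpace_eq_iff.1 (show F.toSpace j y = F.toSpace i x from h.symm)
    exact ⟨⟨y, hy⟩, hx, rfl⟩
  · rintro ⟨y, hy, rfl⟩
    exact ⟨_, hy, toSpace_glue y⟩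

theorem IsOpenGluing.isOpenEmbedding_toSpace_incl (hF : F.IsOpenGluing) (i j : I) :
    IsOpenEmbedding ((F.toSpace i).comp (F.incl i j)) :=
  (hF.isOpenEmbedding_toSpace i).comp (hF.isOpen_region i j).isOpenEmbedding_subtypeVal

theorem pullback_toSpace_mem (c : CechCohomology 1 F.Space G) :
    (fun i => CechCohomology.pullback 1 G (F.toSpace i) c) ∈ F.fibredProduct 1 G := by
  intro i j
  rw [CechCohomology.pullback_pullback, CechCohomology.pullback_pullback, toSpace_comp_incl]

/-! ### Multiple intersections and injectivity -/

open scoped Classical in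
theorem mem_inter_pair {i j : I} {x : F.Space} : x ∈ F.inter {i, j} ↔
    x ∈ Set.range (F.toSpace i) ∧ x ∈ Set.range (F.toSpace j) := by
  simp [inter]

open scoped Classical in
theorem mem_inter_triple {i j k : I} {x : F.Space} : x ∈ F.inter {i, j, k} ↔
    x ∈ Set.range (F.toSpace i) ∧ x ∈ Set.range (F.toSpace j) ∧ x ∈ Set.range (F.toSpace k) := by
  simp [inter]

open scoped Classical in
theorem mem_inter_quadruple {i j k l : I} {x : F.Space} : x ∈ F.inter {i, j, k, l} ↔
    x ∈ Set.range (F.toSpace i) ∧ x ∈ Set.range (F.toSpace j) ∧ x ∈ Set.range (F.toSpace k) ∧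
      x ∈ Set.range (F.toSpace l) := by
  simp [inter]

theorem pullback_toSpace_injective (hF : F.IsOpenGluing)
    (hconn : ∀ s : Finset I, s.Nonempty → IsConnected (F.inter s))
    {c c' : CechCohomology 1 F.Space G}
    (h : ∀ i, CechCohomology.pullback 1 G (F.toSpace i) c =
      CechCohomology.pullback 1 G (F.toSpace i) c') : c = c' := by
  classical
  obtain ⟨U, g, rfl⟩ := LocalCocycle.exists_cechClass_eq c
  obtain ⟨V, g', rfl⟩ := LocalCocycle.exists_cechClass_eq c'
  simp only [LocalCocycle.pullback_cechClass, LocalCocycle.cechClass_eq_iff] at h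
  choose h hloc hh using h
  let H (i : I) (a : U.ι) (b : V.ι) : F.Space → G := Function.extend (F.toSpace i) (h i a b) 0
  have H_toSpace (i a b y) : H i a b (F.toSpace i y) = h i a b y :=
    (toSpace_injective i).extend_apply _ _ _
  have Hloc (i a b x) (hx : x ∈ Set.range (F.toSpace i)) (ha : x ∈ U.set a) (hb : x ∈ V.set b) :
      LocConstAt (H i a b) x := by
    obtain ⟨y, rfl⟩ := hx
    exact (hloc i a b y ha hb).extend (hF.isOpenEmbedding_toSpace i)
  have Hrel (i a a' b b' x) (hx : x ∈ Set.range (F.toSpace i)) (ha : x ∈ U.set a)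
      (ha' : x ∈ U.set a') (hb : x ∈ V.set b) (hb' : x ∈ V.set b') :
      H i a b x + g'.val b b' x = g.val a a' x + H i a' b' x := by
    obtain ⟨y, rfl⟩ := hx
    rw [H_toSpace, H_toSpace]
    exact hh i a a' b b' y ha ha' hb hb'
  -- Passing from `(a, b)` to `(a', b')` changes both terms by the same values of `g` and `g'`, so
  -- the difference is one locally constant function on the connected double intersection.
  have hk (i j : I) : ∃ k, ∀ ab : U.ι × V.ι, ∀ x ∈ F.inter {i, j}, x ∈ (U.set ab.1 ⊓ V.set ab.2 :
      Opens F.Space) → H i ab.1 ab.2 x - H j ab.1 ab.2 x = k := by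
    refine IsPreconnected.exists_eq_of_locConstAt
      (hconn {i, j} (Finset.insert_nonempty _ _)).isPreconnected
      (fun ab : U.ι × V.ι => (U.set ab.1 ⊓ V.set ab.2 : Opens F.Space))
      (fun ab x => H i ab.1 ab.2 x - H j ab.1 ab.2 x)
      (fun ab => (U.set ab.1 ⊓ V.set ab.2).isOpen) (fun x _ => ?_) ?_ ?_
    · obtain ⟨a, ha⟩ := U.isOpenCover.exists_mem x
      obtain ⟨b, hb⟩ := V.isOpenCover.exists_mem x
      exact ⟨(a, b), ha, hb⟩
    · rintro ⟨a, b⟩ x hx ⟨ha, hb⟩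
      rw [mem_inter_pair] at hx
      exact (Hloc i a b x hx.1 ha hb).sub (Hloc j a b x hx.2 ha hb)
    · rintro ⟨a, b⟩ ⟨a', b'⟩ x hx ⟨ha, hb⟩ ⟨ha', hb'⟩
      rw [mem_inter_pair] at hx
      have h₁ := Hrel i a a' b b' x hx.1 ha ha' hb hb'
      have h₂ := Hrel j a a' b b' x hx.2 ha ha' hb hb'
      dsimp only
      rw [eq_sub_of_add_eq h₁, eq_sub_of_add_eq h₂]
      abel
  choose k hk using hk
  rw [LocalCocycle.cechClass_eq_iff]
  rcases isEmpty_or_nonempty I with hI | ⟨⟨o⟩⟩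
  · have hE (x : F.Space) : False := hI.false (exists_toSpace_eq x).choose
    exact ⟨fun _ _ _ => 0, fun _ _ x => (hE x).elim, fun _ _ _ _ x => (hE x).elim⟩
  choose σ π hπ using exists_toSpace_eq (F := F)
  have hσ (x) : x ∈ Set.range (F.toSpace (σ x)) := ⟨_, hπ x⟩
  -- All three constants are read off at one point of the triple intersection.
  have hkk (i j : I) : k i o - k j o = k i j := by
    obtain ⟨x, hx⟩ := (hconn {i, j, o} (Finset.insert_nonempty _ _)).nonempty
    rw [mem_inter_triple] at hx
    obtain ⟨a, ha⟩ := U.isOpenCover.exists_mem x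
    obtain ⟨b, hb⟩ := V.isOpenCover.exists_mem x
    rw [← hk i o (a, b) x (mem_inter_pair.2 ⟨hx.1, hx.2.2⟩) ⟨ha, hb⟩,
      ← hk j o (a, b) x (mem_inter_pair.2 ⟨hx.2.1, hx.2.2⟩) ⟨ha, hb⟩,
      ← hk i j (a, b) x (mem_inter_pair.2 ⟨hx.1, hx.2.1⟩) ⟨ha, hb⟩]
    abel
  refine ⟨fun a b x => H (σ x) a b x - k (σ x) o, fun a b x ha hb => ?_,
    fun a a' b b' x ha ha' hb hb' => ?_⟩
  · refine ((Hloc (σ x) a b x (hσ x) ha hb).sub (.const (k (σ x) o) x)).congr ?_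
    filter_upwards [(U.set a).isOpen.mem_nhds ha, (V.set b).isOpen.mem_nhds hb,
      (hF.isOpenEmbedding_toSpace (σ x)).isOpen_range.mem_nhds (hσ x)] with y hya hyb hy
    -- The index chosen at `y` may differ from the one at `x`; the two functions differ by `k (σ y)
    -- (σ x)`, which is exactly the difference of the two corrections.
    have h₁ := hk (σ y) (σ x) (a, b) y (mem_inter_pair.2 ⟨hσ y, hy⟩) ⟨hya, hyb⟩
    rw [← hkk, sub_eq_sub_iff_sub_eq_sub] at h₁
    exact h₁
  · have := Hrel (σ x) a a' b b' x (hσ x) ha ha' hb hb'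
    rw [sub_add_eq_add_sub, this, add_sub_assoc]

/-! ### Gluing cocycles and surjectivity -/

/-- The cover of the adjunction space by the images of the members of covers of the `M i`. -/
def glueCover (hF : F.IsOpenGluing) (U : ∀ i, OpenCover (M i)) : OpenCover F.Space where
  ι := Σ i, (U i).ι
  set a := ⟨F.toSpace a.1 '' (U a.1).set a.2,
    (hF.isOpenEmbedding_toSpace a.1).isOpenMap _ ((U a.1).set a.2).isOpen⟩
  isOpenCover := by
    rw [IsOpenCover, eq_top_iff]
    intro x _
    obtain ⟨i, y, rfl⟩ := exists_toSpace_eq x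
    obtain ⟨a, ha⟩ := (U i).isOpenCover.exists_mem y
    exact Opens.mem_iSup.2 ⟨⟨i, a⟩, y, ha, rfl⟩

theorem toSpace_mem_glueCover (hF : F.IsOpenGluing) (U : ∀ i, OpenCover (M i)) {i : I} {y : M i}
    {a : (U i).ι} : F.toSpace i y ∈ (glueCover hF U).set ⟨i, a⟩ ↔ y ∈ (U i).set a := by
  constructor
  · rintro ⟨z, hz, h⟩
    obtain rfl := toSpace_injective i h
    exact hz
  · exact fun h => ⟨y, h, rfl⟩

theorem exists_pullback_toSpace_eq (hF : F.IsOpenGluing)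
    (hconn : ∀ s : Finset I, s.Nonempty → IsConnected (F.inter s))
    {c : ∀ i, CechCohomology 1 (M i) G} (hc : c ∈ F.fibredProduct 1 G) :
    ∃ c', ∀ i, CechCohomology.pullback 1 G (F.toSpace i) c' = c i := by
  classical
  rcases isEmpty_or_nonempty I with hI | ⟨⟨o⟩⟩
  · exact ⟨0, fun i => (hI.false i).elim⟩
  choose U g hg using fun i => LocalCocycle.exists_cechClass_eq (c i)
  obtain rfl : (fun i => (g i).cechClass) = c := funext hg
  have hc' (i j : I) : ((g i).comap (OpenCover.over_comap (F.incl i j) (U i))).Cohomologous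
      ((g j).comap (OpenCover.over_comap (F.glue i j) (U j))) := by
    rw [← LocalCocycle.cechClass_eq_iff, ← LocalCocycle.pullback_cechClass,
      ← LocalCocycle.pullback_cechClass]
    exact hc i j
  choose h hloc hh using hc'
  let W := glueCover hF U
  let Γ (i : I) (a a' : (U i).ι) : F.Space → G := Function.extend (F.toSpace i) ((g i).val a a') 0
  have Γ_toSpace (i a a' y) : Γ i a a' (F.toSpace i y) = (g i).val a a' y :=
    (toSpace_injective i).extend_apply _ _ _
  -- The comparison function moved to the adjunction space; its value zero outside the double
  -- intersection of charts is never used.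
  let H (i j : I) (a : (U i).ι) (b : (U j).ι) : F.Space → G :=
    Function.extend ((F.toSpace i).comp (F.incl i j)) (h i j a b) 0
  have H_toSpace (i j a b) (y : F.region i j) : H i j a b (F.toSpace i y) = h i j a b y :=
    (hF.isOpenEmbedding_toSpace_incl i j).injective.extend_apply _ _ _
  have exists_region {i j : I} {a : (U i).ι} {b : (U j).ι} {x : F.Space} (ha : x ∈ W.set ⟨i, a⟩)
      (hb : x ∈ W.set ⟨j, b⟩) : ∃ y : F.region i j, F.toSpace i y = x := by
    obtain ⟨y, hy, rfl⟩ := ha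
    obtain ⟨z, hz, e⟩ := hb
    obtain ⟨h, rfl⟩ := toSpace_eq_iff.1 e.symm
    exact ⟨⟨y, h⟩, rfl⟩
  have Hloc (i j a b x) (ha : x ∈ W.set ⟨i, a⟩) (hb : x ∈ W.set ⟨j, b⟩) :
      LocConstAt (H i j a b) x := by
    obtain ⟨y, rfl⟩ := exists_region ha hb
    refine LocConstAt.extend (hF.isOpenEmbedding_toSpace_incl i j) (hloc i j a b y ?_ ?_)
    · exact (toSpace_mem_glueCover hF U).1 ha
    · rw [← toSpace_glue] at hb
      exact (toSpace_mem_glueCover hF U).1 hb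
  have Hrel (i j a a' b b' x) (ha : x ∈ W.set ⟨i, a⟩) (ha' : x ∈ W.set ⟨i, a'⟩)
      (hb : x ∈ W.set ⟨j, b⟩) (hb' : x ∈ W.set ⟨j, b'⟩) :
      H i j a b x + Γ j b b' x = Γ i a a' x + H i j a' b' x := by
    obtain ⟨y, rfl⟩ := exists_region ha hb
    rw [H_toSpace, H_toSpace, Γ_toSpace]
    rw [← toSpace_glue] at hb hb' ⊢
    rw [Γ_toSpace]
    exact hh i j a a' b b' y ((toSpace_mem_glueCover hF U).1 ha)
      ((toSpace_mem_glueCover hF U).1 ha') ((toSpace_mem_glueCover hF U).1 hb)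
      ((toSpace_mem_glueCover hF U).1 hb')
  have exists_mem {i : I} {x : F.Space} (hx : x ∈ Set.range (F.toSpace i)) :
      ∃ a, x ∈ W.set ⟨i, a⟩ := by
    obtain ⟨y, rfl⟩ := hx
    obtain ⟨a, ha⟩ := (U i).isOpenCover.exists_mem y
    exact ⟨a, (toSpace_mem_glueCover hF U).2 ha⟩
  have mem_range {i : I} {a : (U i).ι} {x : F.Space} (hx : x ∈ W.set ⟨i, a⟩) :
      x ∈ Set.range (F.toSpace i) := by
    obtain ⟨y, -, e⟩ := hx
    exact ⟨y, e⟩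
  -- The cocycle defect of `H`. By `Hrel`, a change of members of the covers contributes terms `Γ`
  -- that cancel, so the defect depends only on the point, and connectedness makes it constant.
  have hk (i j l : I) : ∃ k, ∀ t : (U i).ι × (U j).ι × (U l).ι, ∀ x ∈ F.inter {i, j, l},
      x ∈ (W.set ⟨i, t.1⟩ ⊓ (W.set ⟨j, t.2.1⟩ ⊓ W.set ⟨l, t.2.2⟩) : Opens F.Space) →
      H i j t.1 t.2.1 x + H j l t.2.1 t.2.2 x - H i l t.1 t.2.2 x = k := by
    refine IsPreconnected.exists_eq_of_locConstAt
      (hconn {i, j, l} (Finset.insert_nonempty _ _)).isPreconnected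
      (fun t : (U i).ι × (U j).ι × (U l).ι =>
        (W.set ⟨i, t.1⟩ ⊓ (W.set ⟨j, t.2.1⟩ ⊓ W.set ⟨l, t.2.2⟩) : Opens F.Space))
      (fun t x => H i j t.1 t.2.1 x + H j l t.2.1 t.2.2 x - H i l t.1 t.2.2 x)
      (fun t => (W.set ⟨i, t.1⟩ ⊓ (W.set ⟨j, t.2.1⟩ ⊓ W.set ⟨l, t.2.2⟩)).isOpen)
      (fun x hx => ?_) ?_ ?_
    · rw [mem_inter_triple] at hx
      obtain ⟨a, ha⟩ := exists_mem hx.1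
      obtain ⟨b, hb⟩ := exists_mem hx.2.1
      obtain ⟨c, hc⟩ := exists_mem hx.2.2
      exact ⟨(a, b, c), ha, hb, hc⟩
    · rintro ⟨a, b, c⟩ x - ⟨ha, hb, hc⟩
      exact ((Hloc i j a b x ha hb).add (Hloc j l b c x hb hc)).sub (Hloc i l a c x ha hc)
    · rintro ⟨a, b, c⟩ ⟨a', b', c'⟩ x - ⟨ha, hb, hc⟩ ⟨ha', hb', hc'⟩
      dsimp only
      rw [eq_sub_of_add_eq (Hrel i j a a' b b' x ha ha' hb hb'),
        eq_sub_of_add_eq (Hrel j l b b' c c' x hb hb' hc hc'),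
        eq_sub_of_add_eq (Hrel i l a a' c c' x ha ha' hc hc')]
      abel
  choose k hk using hk
  -- At a point of the fourfold intersection each constant is a defect of the same functions `H`,
  -- and the alternating sum telescopes.
  have hkk (i j l : I) : k i j o + k j l o - k i l o = k i j l := by
    obtain ⟨x, hx⟩ := (hconn {i, j, l, o} (Finset.insert_nonempty _ _)).nonempty
    rw [mem_inter_quadruple] at hx
    obtain ⟨a, ha⟩ := exists_mem hx.1
    obtain ⟨b, hb⟩ := exists_mem hx.2.1
    obtain ⟨c, hc⟩ := exists_mem hx.2.2.1
    obtain ⟨e, he⟩ := exists_mem hx.2.2.2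
    rw [← hk i j o (a, b, e) x (mem_inter_triple.2 ⟨hx.1, hx.2.1, hx.2.2.2⟩) ⟨ha, hb, he⟩,
      ← hk j l o (b, c, e) x (mem_inter_triple.2 hx.2) ⟨hb, hc, he⟩,
      ← hk i l o (a, c, e) x (mem_inter_triple.2 ⟨hx.1, hx.2.2⟩) ⟨ha, hc, he⟩,
      ← hk i j l (a, b, c) x (mem_inter_triple.2 ⟨hx.1, hx.2.1, hx.2.2.1⟩) ⟨ha, hb, hc⟩]
    abel
  let γ : LocalCocycle W G := {
    val a b x := H a.1 b.1 a.2 b.2 x - k a.1 b.1 o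
    locConst a b x ha hb := (Hloc _ _ _ _ x ha hb).sub (.const _ x)
    cocycle := by
      rintro ⟨i, a⟩ ⟨j, b⟩ ⟨l, c⟩ x ha hb hc
      have h₁ := hk i j l (a, b, c) x
        (mem_inter_triple.2 ⟨mem_range ha, mem_range hb, mem_range hc⟩) ⟨ha, hb, hc⟩
      rw [← hkk, sub_eq_sub_iff_sub_eq_sub] at h₁
      rw [← h₁]
      abel }
  -- Within one chart, `H i i` differs from the given cocycle by its diagonal value; this value is
  -- `k i i o` because a cocycle vanishes on the diagonal, so the correction removes it.
  have hγ (i a a' x) (ha : x ∈ W.set ⟨i, a⟩) (ha' : x ∈ W.set ⟨i, a'⟩) :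
      γ.val ⟨i, a⟩ ⟨i, a'⟩ x = Γ i a a' x := by
    have h₁ := Hrel i i a a' a' a' x ha ha' ha' ha'
    have h₂ : Γ i a' a' x = 0 := by
      obtain ⟨y, rfl⟩ := mem_range ha'
      rw [Γ_toSpace, (g i).val_self ((toSpace_mem_glueCover hF U).1 ha')]
    have h₃ : H i i a' a' x - k i i o = 0 := γ.val_self ha'
    rw [h₂, add_zero, sub_eq_zero.1 h₃] at h₁
    exact sub_eq_of_eq_add h₁
  refine ⟨γ.cechClass, fun i => ?_⟩
  rw [LocalCocycle.pullback_cechClass, LocalCocycle.cechClass_eq_iff]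
  -- The comparison cochain is `γ` itself, evaluated between an arbitrary member of `W` and the
  -- image of a member of `U i`; by `hγ` the required relation becomes the cocycle identity of `γ`.
  refine ⟨fun b a y => γ.val b ⟨i, a⟩ (F.toSpace i y), fun b a y hb ha => ?_,
    fun b b' a a' y hb hb' ha ha' => ?_⟩
  · exact (γ.locConst b ⟨i, a⟩ _ hb ((toSpace_mem_glueCover hF U).2 ha)).comp
      (F.toSpace i).continuous.continuousAt
  · have ha₁ : F.toSpace i y ∈ W.set ⟨i, a⟩ := (toSpace_mem_glueCover hF U).2 ha
    have ha₂ : F.toSpace i y ∈ W.set ⟨i, a'⟩ := (toSpace_mem_glueCover hF U).2 ha'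
    rw [← Γ_toSpace, ← hγ i a a' _ ha₁ ha₂]
    exact (γ.cocycle b _ _ _ hb ha₁ ha₂).trans (γ.cocycle b b' _ _ hb hb' ha₂).symm

end AdjunctionSystem

theorem mainTheorem10 {I : Type} [Finite I] (d : ℕ) (M : I → Type u)
    [∀ i, TopologicalSpace (M i)] [∀ i, T2Space (M i)] [∀ i, SecondCountableTopology (M i)]
    [∀ i, ChartedSpace (EuclideanSpace ℝ (Fin d)) (M i)]
    (F : AdjunctionSystem M) (hF : F.IsOpenGluing)
    (hconn : ∀ s : Finset I, s.Nonempty → IsConnected (F.inter s))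
    (G : Type v) [AddCommGroup G] :
    ∃ e : CechCohomology 1 F.Space G ≃+ F.fibredProduct 1 G,
      ∀ c i, (e c : ∀ i, CechCohomology 1 (M i) G) i =
        CechCohomology.pullback 1 G (F.toSpace i) c := by
  let f : CechCohomology 1 F.Space G →+ F.fibredProduct 1 G :=
    { toFun := fun c => ⟨fun i => CechCohomology.pullback 1 G (F.toSpace i) c,
        AdjunctionSystem.pullback_toSpace_mem c⟩
      map_zero' := Subtype.ext (funext fun i => (CechCohomology.pullback 1 G _).map_zero)
      map_add' := fun c c' =>
        Subtype.ext (funext fun i => (CechCohomology.pullback 1 G _).map_add c c') }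
  refine ⟨AddEquiv.ofBijective f ⟨fun c c' h => ?_, fun c => ?_⟩, fun c i => rfl⟩
  · exact AdjunctionSystem.pullback_toSpace_injective hF hconn
      fun i => congrFun (congrArg Subtype.val h) i
  · obtain ⟨c', h⟩ := AdjunctionSystem.exists_pullback_toSpace_eq hF hconn c.2
    exact ⟨c', Subtype.ext (funext h)⟩
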